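/- Let $E$ and $F$ be (real) Banach lattices and let $E'$ be the norm dual of $E$ with its usual order ($f\le g$ iff $f(x)\le g(x)$ for all $x\ge 0$). All operators are continuous and linear. An operator $T:E\to F$ is weak Dunford–Pettis if $f_n(Tx_n)\to 0$ for every weakly null sequence $(x_n)$ in $E$ and every weakly null sequence $(f_n)$ in $F'$ (weakly null with respect to $F''$). It is uaw-Dunford–Pettis if $\|Tx_n\|\to 0$ for every norm bounded sequence $(x_n)$ in $E$ such that $|x_n|\wedge u\to 0$ weakly for every $u\in E_+$. The norm of a Banach lattice is order continuous if $\|x_\alpha\|\to 0$ for every net $x_\alpha\downarrow 0$ (decreasing with infimum $0$). If every weak Dunford–Pettis operator $T:E\to F$ is uaw-Dunford–Pettis, then at least one of the following holds: 1. the norm of $E'$ is order continuous; 2. the norm of $F$ is order continuous. -/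

import Mathlib

open Filter Topology

/-- A family `x` converges weakly to `a` along the filter `l`: it does so against every
continuous linear functional. -/
def WeaklyTendsto {X ι : Type*} [NormedAddCommGroup X] [NormedSpace ℝ X]
    (x : ι → X) (l : Filter ι) (a : X) : Prop :=
  ∀ f : StrongDual ℝ X, Tendsto (fun i => f (x i)) l (𝓝 (f a))

/-- Unbounded absolute weak convergence in a Banach lattice: `|x i - a| ⊓ u` converges weakly
to `0` for every `u ≥ 0`. -/
def UawTendsto {E ι : Type*} [NormedAddCommGroup E] [NormedSpace ℝ E] [Lattice E]
    (x : ι → E) (l : Filter ι) (a : E) : Prop :=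
  ∀ u : E, 0 ≤ u → WeaklyTendsto (fun i => |x i - a| ⊓ u) l 0

/-- A continuous operator `T : X → Y` between Banach spaces is weak Dunford–Pettis if
`f n (T (x n)) → 0` for all weakly null sequences `x` in `X` and `f` in the dual of `Y`
(the latter with respect to the bidual of `Y`). -/
def IsWeakDunfordPettis {X Y : Type*} [NormedAddCommGroup X] [NormedSpace ℝ X]
    [NormedAddCommGroup Y] [NormedSpace ℝ Y] (T : X →L[ℝ] Y) : Prop :=
  ∀ (x : ℕ → X) (f : ℕ → StrongDual ℝ Y), WeaklyTendsto x atTop 0 → WeaklyTendsto f atTop 0 →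
    Tendsto (fun n => f n (T (x n))) atTop (𝓝 0)

/-- A continuous operator `T` from a Banach lattice to a Banach space is unbounded absolute weak
Dunford–Pettis if it maps norm bounded uaw-null sequences to norm null sequences. -/
def IsUawDunfordPettis {E Y : Type*} [NormedAddCommGroup E] [NormedSpace ℝ E] [Lattice E]
    [NormedAddCommGroup Y] [NormedSpace ℝ Y] (T : E →L[ℝ] Y) : Prop :=
  ∀ x : ℕ → E, Bornology.IsBounded (Set.range x) → UawTendsto x atTop 0 →
    Tendsto (fun n => ‖T (x n)‖) atTop (𝓝 0)

/-- The norm is order continuous: every decreasing net with infimum `0` is norm null.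
Index sets in the universe of `E` suffice, since the range of a decreasing net, indexed by itself,
is again a decreasing net. -/
def HasOrderContinuousNorm.{u} (E : Type u) [NormedAddCommGroup E] [PartialOrder E] : Prop :=
  ∀ (ι : Type u) [Preorder ι] [IsDirectedOrder ι] [Nonempty ι] (x : ι → E),
    Antitone x → IsGLB (Set.range x) 0 → Tendsto (fun i => ‖x i‖) atTop (𝓝 0)

/-- The positive cone of a Banach lattice spans it, so a continuous functional that vanishes on
the positive cone is zero. -/
theorem StrongDual.ext_of_nonneg {E : Type*} [NormedAddCommGroup E] [NormedSpace ℝ E]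
    [Lattice E] [IsOrderedAddMonoid E] {f g : StrongDual ℝ E}
    (h : ∀ x : E, 0 ≤ x → f x = g x) : f = g := by
  ext x
  rw [← posPart_sub_negPart x, map_sub, map_sub, h _ (posPart_nonneg x), h _ (negPart_nonneg x)]

/-- The order of the dual Banach lattice: `f ≤ g` if `f x ≤ g x` for all `x ≥ 0`. -/
instance StrongDual.instPartialOrderOfLattice {E : Type*} [NormedAddCommGroup E] [NormedSpace ℝ E]
    [Lattice E] [IsOrderedAddMonoid E] : PartialOrder (StrongDual ℝ E) where
  le f g := ∀ x : E, 0 ≤ x → f x ≤ g x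
  le_refl _ _ _ := le_rfl
  le_trans _ _ _ hfg hgh x hx := (hfg x hx).trans (hgh x hx)
  le_antisymm _ _ hfg hgf := StrongDual.ext_of_nonneg fun x hx => (hfg x hx).antisymm (hgf x hx)

/-!
The hypothesis is only needed for operators of rank one. If `F` is trivial, its norm is order
continuous. Otherwise fix `y ≠ 0` in `F`; for every functional `f` on `E` the operator `x ↦ f x • y`
is weak Dunford–Pettis, hence uaw-Dunford–Pettis, so that `f` maps bounded uaw-null sequences to
null sequences (`tendsto_apply_of_uaw`). It remains to see that this property of `E` makes the norm
of the dual order continuous.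

A bounded positive disjoint sequence is uaw-null (`uawTendsto_of_disjoint`): for `u ≥ 0` the signed
finite sums of the `x n ⊓ u` are dominated by `u`, so the series of the values of a functional
converges absolutely. Hence every functional tends to zero along bounded positive disjoint
sequences. On the other hand, a decreasing net of functionals with infimum `0` is pointwise null
(`tendsto_apply_of_isGLB_zero`). If its norms stayed above some `ε > 0`, one could choose indices
`α n` and positive `z n` in the unit ball with `φ (α n) (z n) > ε / 2` and `φ (α n) (z i)` tiny for
`i < n`. Subtracting from `z n` a large multiple of its predecessors and a small multiple of
`∑ 2⁻ⁱ z i` and taking positive parts makes the sequence disjoint (`disjointified_inf_eq_zero`)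
while losing little of the value of `φ (α n)`. Then `φ (α 0)`, which dominates every `φ (α n)`,
stays away from zero along a bounded disjoint sequence.
-/

/-! ### Disjointness in vector lattices -/

section Lattice

variable {E : Type*} [AddCommGroup E] [Lattice E] [IsOrderedAddMonoid E]

theorem add_inf_eq_zero_of_inf_eq_zero {a b c : E} (ha : 0 ≤ a) (hb : 0 ≤ b) (hc : 0 ≤ c)
    (hac : a ⊓ c = 0) (hbc : b ⊓ c = 0) : (a + b) ⊓ c = 0 := by
  refine le_antisymm ?_ (le_inf (add_nonneg ha hb) hc)
  have h1 : (a + b) ⊓ c - b ≤ a ⊓ c :=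
    le_inf (sub_le_iff_le_add.2 inf_le_left) ((sub_le_self _ hb).trans inf_le_right)
  rw [hac, sub_nonpos] at h1
  exact (le_inf h1 inf_le_right).trans hbc.le

/-- A finite sum of pairwise disjoint positive elements is their supremum, hence lies below every
common upper bound. -/
theorem sum_range_le_of_disjoint {v : ℕ → E} {u : E} (hv : ∀ n, 0 ≤ v n) (hvu : ∀ n, v n ≤ u)
    (hd : ∀ m n, m < n → v m ⊓ v n = 0) (N : ℕ) : ∑ n ∈ Finset.range N, v n ≤ u := by
  have hdisj : ∀ N m, N ≤ m → (∑ n ∈ Finset.range N, v n) ⊓ v m = 0 := by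
    intro N
    induction N with
    | zero => intro m _; simpa using hv m
    | succ N ih =>
      intro m hm
      rw [Finset.sum_range_succ]
      exact add_inf_eq_zero_of_inf_eq_zero (Finset.sum_nonneg fun i _ => hv i) (hv N) (hv m)
        (ih m (by omega)) (hd N m hm)
  induction N with
  | zero => simpa using (hv 0).trans (hvu 0)
  | succ N ih =>
    rw [Finset.sum_range_succ, ← inf_add_sup, hdisj N N le_rfl, zero_add]
    exact sup_le ih (hvu N)

variable [Module ℝ E] [IsOrderedModule ℝ E]

theorem inf_smul_eq_zero_of_inf_eq_zero {a b : E} (ha : 0 ≤ a) (hb : 0 ≤ b) (hab : a ⊓ b = 0)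
    {c : ℝ} (hc : 1 ≤ c) : a ⊓ c • b = 0 := by
  have hc0 : 0 < c := by linarith
  refine le_antisymm ?_ (le_inf ha (smul_nonneg hc0.le hb))
  have h1 : c⁻¹ • (a ⊓ c • b) ≤ a ⊓ b := by
    refine le_inf ?_ ?_
    · calc c⁻¹ • (a ⊓ c • b) ≤ c⁻¹ • a := smul_le_smul_of_nonneg_left inf_le_left (by positivity)
        _ ≤ (1 : ℝ) • a := smul_le_smul_of_nonneg_right (inv_le_one_of_one_le₀ hc) ha
        _ = a := one_smul _ _
    · calc c⁻¹ • (a ⊓ c • b) ≤ c⁻¹ • c • b :=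
            smul_le_smul_of_nonneg_left inf_le_right (by positivity)
        _ = b := inv_smul_smul₀ hc0.ne' b
  rw [hab] at h1
  simpa [smul_smul, hc0.ne'] using smul_le_smul_of_nonneg_left h1 hc0.le

/-- The `n`-th term of the disjoint sequence derived from a positive sequence `z`. It is meant for
an `x` that dominates all the `2⁻ⁿ • z n`. -/
noncomputable def disjointified (z : ℕ → E) (x : E) (n : ℕ) : E :=
  (z n - (4 : ℝ) ^ n • ∑ i ∈ Finset.range n, z i - ((2 : ℝ) ^ n)⁻¹ • x)⁺

theorem disjointified_nonneg {E : Type*} [AddCommGroup E] [Lattice E] [Module ℝ E]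
    (z : ℕ → E) (x : E) (n : ℕ) : 0 ≤ disjointified z x n :=
  posPart_nonneg _

theorem disjointified_le {z : ℕ → E} {x : E} (hz : ∀ n, 0 ≤ z n) (hx : 0 ≤ x) (n : ℕ) :
    disjointified z x n ≤ z n := by
  refine sup_le ?_ (hz n)
  have h1 : 0 ≤ (4 : ℝ) ^ n • ∑ i ∈ Finset.range n, z i :=
    smul_nonneg (by positivity) (Finset.sum_nonneg fun i _ => hz i)
  have h2 : 0 ≤ ((2 : ℝ) ^ n)⁻¹ • x := smul_nonneg (by positivity) hx
  exact (sub_le_self _ h2).trans (sub_le_self _ h1)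

/-- For `m < n`, the `m`-th term lies below the positive part of `z m - 2⁻ᵐ x` and the `n`-th one
below a multiple of its negative part. -/
theorem disjointified_inf_eq_zero {z : ℕ → E} {x : E} (hz : ∀ n, 0 ≤ z n) (hx : 0 ≤ x)
    (hzx : ∀ n, z n ≤ (2 : ℝ) ^ n • x) {m n : ℕ} (hmn : m < n) :
    disjointified z x m ⊓ disjointified z x n = 0 := by
  set a : E := z m - ((2 : ℝ) ^ m)⁻¹ • x with ha
  have h1 : disjointified z x m ≤ a⁺ := by
    refine posPart_mono (sub_le_sub_right (sub_le_self _ ?_) _)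
    exact smul_nonneg (by positivity) (Finset.sum_nonneg fun i _ => hz i)
  have h2 : disjointified z x n ≤ (4 : ℝ) ^ n • a⁻ := by
    refine sup_le ?_ (smul_nonneg (by positivity) (negPart_nonneg a))
    have h3 : (4 : ℝ) ^ n • z m ≤ (4 : ℝ) ^ n • ∑ i ∈ Finset.range n, z i :=
      smul_le_smul_of_nonneg_left
        (Finset.single_le_sum (fun i _ => hz i) (Finset.mem_range.2 hmn)) (by positivity)
    have h4 : (2 : ℝ) ^ n • x ≤ ((4 : ℝ) ^ n * ((2 : ℝ) ^ m)⁻¹) • x := by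
      refine smul_le_smul_of_nonneg_right ?_ hx
      rw [le_mul_inv_iff₀ (by positivity), show (4 : ℝ) = 2 * 2 by norm_num, mul_pow]
      gcongr
      norm_num
    calc z n - (4 : ℝ) ^ n • ∑ i ∈ Finset.range n, z i - ((2 : ℝ) ^ n)⁻¹ • x
        ≤ z n - (4 : ℝ) ^ n • ∑ i ∈ Finset.range n, z i :=
          sub_le_self _ (smul_nonneg (by positivity) hx)
      _ ≤ ((4 : ℝ) ^ n * ((2 : ℝ) ^ m)⁻¹) • x - (4 : ℝ) ^ n • z m :=
          sub_le_sub ((hzx n).trans h4) h3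
      _ = (4 : ℝ) ^ n • (-a) := by rw [ha, neg_sub, smul_sub, smul_smul]
      _ ≤ (4 : ℝ) ^ n • a⁻ := smul_le_smul_of_nonneg_left (neg_le_negPart a) (by positivity)
  have h5 := inf_smul_eq_zero_of_inf_eq_zero (posPart_nonneg a) (negPart_nonneg a)
    (posPart_inf_negPart_eq_zero a) (c := (4 : ℝ) ^ n) (one_le_pow₀ (by norm_num))
  exact le_antisymm ((inf_le_inf h1 h2).trans h5.le)
    (le_inf (disjointified_nonneg _ _ _) (disjointified_nonneg _ _ _))

end Lattice

section BanachLattice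

variable {E : Type*} [NormedAddCommGroup E] [NormedSpace ℝ E] [Lattice E]
  [IsOrderedAddMonoid E] [HasSolidNorm E]

/-! ### Decreasing nets of functionals -/

theorem apply_le_apply_of_nonneg {E : Type*} [NormedAddCommGroup E] [NormedSpace ℝ E] [Lattice E]
    [IsOrderedAddMonoid E] {f : StrongDual ℝ E} (hf : 0 ≤ f) {a b : E} (hab : a ≤ b) : f a ≤ f b := by
  simpa using hf (b - a) (sub_nonneg.2 hab)

/-- The norm of a positive functional is determined by its values at positive vectors. -/
theorem exists_nonneg_lt_apply {f : StrongDual ℝ E} (hf : 0 ≤ f) {r : ℝ} (hr : r < ‖f‖) :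
    ∃ x : E, 0 ≤ x ∧ ‖x‖ ≤ 1 ∧ r < f x := by
  obtain ⟨x, hx1, hx⟩ := f.exists_lt_apply_of_lt_opNorm hr
  refine ⟨|x|, abs_nonneg x, (norm_abs_eq_norm x).trans_le hx1.le, hx.trans_le ?_⟩
  refine abs_le'.2 ⟨apply_le_apply_of_nonneg hf (le_abs_self x), ?_⟩
  rw [← map_neg]
  exact apply_le_apply_of_nonneg hf (neg_le_abs x)

theorem norm_le_norm_of_nonneg_of_le {f g : StrongDual ℝ E} (hf : 0 ≤ f) (hfg : f ≤ g) :
    ‖f‖ ≤ ‖g‖ := by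
  by_contra! hlt
  obtain ⟨x, hx, hx1, hgx⟩ := exists_nonneg_lt_apply hf hlt
  have h1 : f x ≤ ‖g‖ := (hfg x hx).trans <| (Real.le_norm_self _).trans <|
    (g.le_opNorm x).trans (mul_le_of_le_one_right (norm_nonneg g) hx1)
  linarith

/-- A decreasing net of functionals with infimum `0` is pointwise null: its pointwise limit exists
and is a continuous functional, hence a lower bound of the net. -/
theorem tendsto_apply_of_isGLB_zero {ι : Type*} [Preorder ι] [IsDirectedOrder ι] [Nonempty ι]
    {φ : ι → StrongDual ℝ E} (hanti : Antitone φ) (hglb : IsGLB (Set.range φ) 0) {x : E}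
    (hx : 0 ≤ x) : Tendsto (fun i => φ i x) atTop (𝓝 0) := by
  have hpos : ∀ i, 0 ≤ φ i := fun i => hglb.1 ⟨i, rfl⟩
  have hval : ∀ i (y : E), 0 ≤ y → 0 ≤ φ i y := fun i y hy => by simpa using hpos i y hy
  have hinf : ∀ y : E, 0 ≤ y → Tendsto (fun i => φ i y) atTop (𝓝 (⨅ i, φ i y)) := fun y hy =>
    tendsto_atTop_ciInf (fun i j hij => hanti hij y hy)
      ⟨0, by rintro _ ⟨i, rfl⟩; exact hval i y hy⟩
  have hlim : ∀ y : E, ∃ l : ℝ, Tendsto (fun i => φ i y) atTop (𝓝 l) := fun y =>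
    ⟨_, ((hinf _ (posPart_nonneg y)).sub (hinf _ (negPart_nonneg y))).congr fun i => by
      rw [← map_sub, posPart_sub_negPart]⟩
  choose G hG using hlim
  obtain ⟨i₀⟩ := ‹Nonempty ι›
  let L : E →ₗ[ℝ] ℝ :=
    { toFun := G
      map_add' := fun a b => tendsto_nhds_unique (hG (a + b)) <| by
        simpa using (hG a).add (hG b)
      map_smul' := fun c a => tendsto_nhds_unique (hG (c • a)) <| by
        simpa using (hG a).const_mul c }
  let g : StrongDual ℝ E := L.mkContinuous ‖φ i₀‖ fun y => by
    refine le_of_tendsto (hG y).norm ((eventually_ge_atTop i₀).mono fun i hi => ?_)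
    exact ((φ i).le_opNorm y).trans
      (mul_le_mul_of_nonneg_right (norm_le_norm_of_nonneg_of_le (hpos i) (hanti hi))
        (norm_nonneg y))
  have hg : ∀ y, g y = G y := fun _ => rfl
  have hg0 : g ≤ 0 := hglb.2 <| by
    rintro _ ⟨i, rfl⟩ y hy
    rw [hg]
    exact le_of_tendsto (hG y) ((eventually_ge_atTop i).mono fun j hj => hanti hj y hy)
  have h0 : G x = 0 := le_antisymm (by simpa [hg] using hg0 x hx)
    (ge_of_tendsto' (hG x) fun i => hval i x hx)
  simpa [h0] using hG x

/-- Along a decreasing net of functionals with infimum `0` and norms bounded away from `0`, one can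
choose positive vectors in the unit ball at which the functionals are large, while the later
functionals are very small at the earlier vectors. -/
theorem exists_almost_biorthogonal {ι : Type*} [Preorder ι] [IsDirectedOrder ι] [Nonempty ι]
    {φ : ι → StrongDual ℝ E} (hanti : Antitone φ) (hglb : IsGLB (Set.range φ) 0) {ε : ℝ}
    (hε : 0 < ε) (hφ : ∀ i, ε ≤ ‖φ i‖) :
    ∃ (α : ℕ → ι) (z : ℕ → E), Monotone α ∧ (∀ n, 0 ≤ z n) ∧ (∀ n, ‖z n‖ ≤ 1) ∧
      (∀ n, ε / 2 < φ (α n) (z n)) ∧ ∀ m n, m < n → 8 ^ n * φ (α n) (z m) < ε / 8 := by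
  have hpos : ∀ i, 0 ≤ φ i := fun i => hglb.1 ⟨i, rfl⟩
  have hw : ∀ i, ∃ x : E, 0 ≤ x ∧ ‖x‖ ≤ 1 ∧ ε / 2 < φ i x := fun i =>
    exists_nonneg_lt_apply (hpos i) ((half_lt_self hε).trans_le (hφ i))
  choose w hw0 hw1 hw2 using hw
  -- The counter `k` carried along with the index only ensures that the `n`-th choice is at least
  -- as good as the factor `8 ^ n` demands.
  obtain ⟨p, -, hp⟩ := exists_seq_of_forall_finset_exists (fun _ : ℕ × ι => True)
    (fun p q => p.1 < q.1 ∧ p.2 ≤ q.2 ∧ 8 ^ q.1 * φ q.2 (w p.2) < ε / 8) <| by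
    intro s _
    let k : ℕ := s.sup Prod.fst + 1
    have hev : ∀ᶠ i in atTop, ∀ q ∈ s, q.2 ≤ i ∧ 8 ^ k * φ i (w q.2) < ε / 8 := by
      rw [Finset.eventually_all]
      intro q _
      refine (eventually_ge_atTop q.2).and ?_
      have ht := (tendsto_apply_of_isGLB_zero hanti hglb (hw0 q.2)).const_mul ((8 : ℝ) ^ k)
      rw [mul_zero] at ht
      exact ht.eventually_lt_const (by positivity)
    obtain ⟨i, hi⟩ := hev.exists
    exact ⟨(k, i), trivial, fun q hq =>
      ⟨Nat.lt_succ_of_le (Finset.le_sup (f := Prod.fst) hq), hi q hq⟩⟩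
  have hk : StrictMono fun n => (p n).1 := fun m n hmn => (hp m n hmn).1
  refine ⟨fun n => (p n).2, fun n => w (p n).2, ?_, fun n => hw0 _, fun n => hw1 _,
    fun n => hw2 _, fun m n hmn => ?_⟩
  · exact monotone_nat_of_le_succ fun n => (hp n (n + 1) n.lt_succ_self).2.1
  · refine lt_of_le_of_lt ?_ (hp m n hmn).2.2
    have h0 : 0 ≤ φ (p n).2 (w (p m).2) := by simpa using hpos (p n).2 _ (hw0 (p m).2)
    exact mul_le_mul_of_nonneg_right (pow_le_pow_right₀ (by norm_num) hk.le_apply) h0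

variable [IsOrderedModule ℝ E]

/-! ### Disjoint sequences are uaw-null -/

/-- An order bounded positive disjoint sequence is weakly null. Choosing signs avoids splitting the
functional into its positive and negative parts. -/
theorem weaklyTendsto_zero_of_disjoint {v : ℕ → E} {u : E} (hv : ∀ n, 0 ≤ v n)
    (hvu : ∀ n, v n ≤ u) (hd : ∀ m n, m < n → v m ⊓ v n = 0) : WeaklyTendsto v atTop 0 := by
  intro g
  have hsum : ∀ N, ∑ n ∈ Finset.range N, |g (v n)| ≤ ‖g‖ * ‖u‖ := by
    intro N
    have hle : |∑ n ∈ Finset.range N, (SignType.sign (g (v n)) : ℝ) • v n| ≤ |u| := by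
      refine le_trans ?_ ((sum_range_le_of_disjoint hv hvu hd N).trans (le_abs_self u))
      have hterm : ∀ n, (SignType.sign (g (v n)) : ℝ) • v n ≤ v n ∧
          -((SignType.sign (g (v n)) : ℝ) • v n) ≤ v n := by
        intro n
        have hs : |(SignType.sign (g (v n)) : ℝ)| ≤ 1 := by
          rcases SignType.sign (g (v n)) with _ | _ | _ <;> simp
        rw [abs_le] at hs
        constructor
        · simpa using smul_le_smul_of_nonneg_right hs.2 (hv n)
        · rw [← neg_smul]
          simpa using smul_le_smul_of_nonneg_right (neg_le.1 hs.1) (hv n)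
      refine abs_le'.2 ⟨Finset.sum_le_sum fun n _ => (hterm n).1, ?_⟩
      rw [← Finset.sum_neg_distrib]
      exact Finset.sum_le_sum fun n _ => (hterm n).2
    calc ∑ n ∈ Finset.range N, |g (v n)|
        = g (∑ n ∈ Finset.range N, (SignType.sign (g (v n)) : ℝ) • v n) := by
          simp [map_sum, sign_mul_self]
      _ ≤ ‖g (∑ n ∈ Finset.range N, (SignType.sign (g (v n)) : ℝ) • v n)‖ := Real.le_norm_self _
      _ ≤ ‖g‖ * ‖∑ n ∈ Finset.range N, (SignType.sign (g (v n)) : ℝ) • v n‖ := g.le_opNorm _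
      _ ≤ ‖g‖ * ‖u‖ := by
          gcongr
          exact norm_le_norm_of_abs_le_abs hle
  have hs : Summable fun n => |g (v n)| :=
    summable_of_sum_range_le (fun n => abs_nonneg _) hsum
  rw [map_zero]
  exact tendsto_zero_iff_abs_tendsto_zero _ |>.2 hs.tendsto_atTop_zero

theorem uawTendsto_of_disjoint {x : ℕ → E} (hx : ∀ n, 0 ≤ x n)
    (hd : ∀ m n, m < n → x m ⊓ x n = 0) : UawTendsto x atTop 0 := by
  intro u hu
  simp only [sub_zero, abs_of_nonneg (hx _)]
  refine weaklyTendsto_zero_of_disjoint (fun n => le_inf (hx n) hu) (fun n => inf_le_right) ?_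
  intro m n hmn
  rw [← inf_inf_distrib_right, hd m n hmn, inf_eq_left.2 hu]

/-! ### Order continuity of the dual norm -/

/-- If all functionals tend to zero along bounded positive disjoint sequences, then the norm of
the dual is order continuous. -/
theorem hasOrderContinuousNorm_dual_of_disjoint [CompleteSpace E]
    (h : ∀ x : ℕ → E, (∀ n, 0 ≤ x n) → (∀ n, ‖x n‖ ≤ 1) → (∀ m n, m < n → x m ⊓ x n = 0) →
      WeaklyTendsto x atTop 0) : HasOrderContinuousNorm (StrongDual ℝ E) := by
  intro ι _ _ _ φ hanti hglb
  have hpos : ∀ i, 0 ≤ φ i := fun i => hglb.1 ⟨i, rfl⟩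
  by_contra hnot
  obtain ⟨ε, hε, hφ⟩ : ∃ ε > 0, ∀ i, ε ≤ ‖φ i‖ := by
    by_contra! hcon
    refine hnot (Metric.tendsto_nhds.2 fun ε hε => ?_)
    obtain ⟨i, hi⟩ := hcon ε hε
    refine (eventually_ge_atTop i).mono fun j hj => ?_
    rw [dist_zero_right, norm_norm]
    exact (norm_le_norm_of_nonneg_of_le (hpos j) (hanti hj)).trans_lt hi
  obtain ⟨α, z, hα, hz0, hz1, hz2, hz3⟩ := exists_almost_biorthogonal hanti hglb hε hφ
  have hsum : Summable fun n => ((2 : ℝ) ^ n)⁻¹ • z n := by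
    refine Summable.of_norm_bounded summable_geometric_two fun n => ?_
    rw [norm_smul, Real.norm_of_nonneg (by positivity), one_div, inv_pow]
    exact mul_le_of_le_one_right (by positivity) (hz1 n)
  have hterm : ∀ n, 0 ≤ ((2 : ℝ) ^ n)⁻¹ • z n := fun n => smul_nonneg (by positivity) (hz0 n)
  set x : E := ∑' n, ((2 : ℝ) ^ n)⁻¹ • z n with hxdef
  have hx : 0 ≤ x := tsum_nonneg hterm
  have hzx : ∀ n, z n ≤ (2 : ℝ) ^ n • x := fun n => by
    have h1 : ((2 : ℝ) ^ n)⁻¹ • z n ≤ x := hsum.le_tsum n fun i _ => hterm i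
    have h2 := smul_le_smul_of_nonneg_left h1 (show (0 : ℝ) ≤ 2 ^ n by positivity)
    rwa [smul_inv_smul₀ (by positivity)] at h2
  have hnull := h (disjointified z x) (disjointified_nonneg z x)
    (fun n => (norm_le_norm_of_abs_le_abs (abs_le_abs_of_nonneg (disjointified_nonneg z x n)
      (disjointified_le hz0 hx n))).trans (hz1 n))
    (fun m n hmn => disjointified_inf_eq_zero hz0 hx hzx hmn) (φ (α 0))
  have hlow : ∀ n, 3 * ε / 8 - ((2 : ℝ) ^ n)⁻¹ * φ (α 0) x ≤ φ (α 0) (disjointified z x n) := by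
    intro n
    have h1 : φ (α n) (disjointified z x n) ≤ φ (α 0) (disjointified z x n) :=
      hanti (hα n.zero_le) _ (disjointified_nonneg z x n)
    have h2 : φ (α n) (z n - (4 : ℝ) ^ n • ∑ i ∈ Finset.range n, z i - ((2 : ℝ) ^ n)⁻¹ • x) ≤
        φ (α n) (disjointified z x n) :=
      apply_le_apply_of_nonneg (hpos (α n)) (le_posPart _)
    simp only [map_sub, map_smul, map_sum, smul_eq_mul] at h2
    have h3 : ((2 : ℝ) ^ n)⁻¹ * φ (α n) x ≤ ((2 : ℝ) ^ n)⁻¹ * φ (α 0) x :=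
      mul_le_mul_of_nonneg_left (hanti (hα n.zero_le) _ hx) (by positivity)
    have h4 : (4 : ℝ) ^ n * ∑ i ∈ Finset.range n, φ (α n) (z i) ≤ ε / 8 := by
      have h5 : ∑ i ∈ Finset.range n, φ (α n) (z i) ≤ n * (ε / 8 / 8 ^ n) := by
        have := Finset.sum_le_card_nsmul (Finset.range n) (fun i => φ (α n) (z i))
          (ε / 8 / 8 ^ n) fun i hi => by
            rw [le_div_iff₀' (by positivity)]
            exact (hz3 i n (Finset.mem_range.1 hi)).le
        simpa using this
      have h6 : (n : ℝ) ≤ 2 ^ n := by exact_mod_cast Nat.lt_two_pow_self.le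
      calc (4 : ℝ) ^ n * ∑ i ∈ Finset.range n, φ (α n) (z i)
          ≤ 4 ^ n * (2 ^ n * (ε / 8 / 8 ^ n)) := by
            gcongr
            exact h5.trans (by gcongr)
        _ = ε / 8 := by
            rw [show (8 : ℝ) = 4 * 2 by norm_num, mul_pow]
            field_simp
    linarith [hz2 n]
  have hlim : Tendsto (fun n : ℕ => 3 * ε / 8 - ((2 : ℝ) ^ n)⁻¹ * φ (α 0) x) atTop
      (𝓝 (3 * ε / 8 - 0 * φ (α 0) x)) :=
    tendsto_const_nhds.sub
      ((tendsto_inv_atTop_zero.comp (tendsto_pow_atTop_atTop_of_one_lt one_lt_two)).mul_const _)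
  have hle := le_of_tendsto_of_tendsto' hlim hnull hlow
  rw [map_zero] at hle
  linarith

end BanachLattice

/-! ### Operators of rank one -/

theorem isWeakDunfordPettis_smulRight {X Y : Type*} [NormedAddCommGroup X] [NormedSpace ℝ X]
    [NormedAddCommGroup Y] [NormedSpace ℝ Y] (f : StrongDual ℝ X) (y : Y) :
    IsWeakDunfordPettis (f.smulRight y) := by
  intro x g hx hg
  have h1 := hx f
  have h2 := hg (NormedSpace.inclusionInDoubleDual ℝ Y y)
  simpa using h1.mul h2

/-- If the rank one operator `x ↦ f x • y` with `y ≠ 0` is uaw-Dunford–Pettis, then so is `f`. -/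
theorem tendsto_apply_of_uaw {E Y : Type*} [NormedAddCommGroup E] [NormedSpace ℝ E] [Lattice E]
    [NormedAddCommGroup Y] [NormedSpace ℝ Y] {f : StrongDual ℝ E} {y : Y} (hy : y ≠ 0)
    (hT : IsUawDunfordPettis (f.smulRight y)) {x : ℕ → E}
    (hb : Bornology.IsBounded (Set.range x)) (hx : UawTendsto x atTop 0) :
    Tendsto (fun n => f (x n)) atTop (𝓝 0) := by
  have h1 := (hT x hb hx).mul_const ‖y‖⁻¹
  have hy' : ‖y‖ ≠ 0 := norm_ne_zero_iff.2 hy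
  rw [zero_mul] at h1
  rw [tendsto_zero_iff_norm_tendsto_zero]
  refine h1.congr fun n => ?_
  rw [ContinuousLinearMap.smulRight_apply, norm_smul, mul_inv_cancel_right₀ hy']

theorem theorem4p3 {E : Type*} {F : Type*}
    [NormedAddCommGroup E] [NormedSpace ℝ E] [CompleteSpace E] [Lattice E]
    [IsOrderedAddMonoid E] [IsOrderedModule ℝ E] [HasSolidNorm E]
    [NormedAddCommGroup F] [NormedSpace ℝ F] [CompleteSpace F] [Lattice F]
    [IsOrderedAddMonoid F] [IsOrderedModule ℝ F] [HasSolidNorm F]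
    (h : ∀ T : E →L[ℝ] F, IsWeakDunfordPettis T → IsUawDunfordPettis T) :
    HasOrderContinuousNorm (StrongDual ℝ E) ∨ HasOrderContinuousNorm F := by
  rcases subsingleton_or_nontrivial F with hF | hF
  · right
    intro ι _ _ _ x _ _
    simp [Subsingleton.elim (x _) 0]
  · left
    obtain ⟨y, hy⟩ := exists_ne (0 : F)
    refine hasOrderContinuousNorm_dual_of_disjoint fun x hx hx1 hd f => ?_
    have hb : Bornology.IsBounded (Set.range x) :=
      (Metric.isBounded_closedBall (x := (0 : E)) (r := 1)).subset <| by
        rintro _ ⟨n, rfl⟩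
        simpa using hx1 n
    rw [map_zero]
    exact tendsto_apply_of_uaw hy (h _ (isWeakDunfordPettis_smulRight f y)) hb
      (uawTendsto_of_disjoint hx hd)
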